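/- Consider the call-by-value $\lambda$-calculus with shift and reset, whose terms, up to $\alpha$-conversion, are $t ::= x \mid \lambda x.t \mid t\,t \mid \mathcal{S}k.t \mid \langle t\rangle$ (here $\lambda x$ and $\mathcal{S}k$ bind $x$, $k$). Values are $V ::= \lambda x.t$; programs $P$ are terms of the form $\langle t\rangle$. Let $E ::= \square \mid V\,E \mid E\,t$ be the pure contexts, $F ::= \square \mid V\,F \mid F\,t \mid \langle F\rangle$ the evaluation contexts, and $C$ range over arbitrary one-hole contexts, whose filling may capture variables. Reduction $\to$ is given by $$F[(\lambda x.t)\,V]\to F[t\{V/x\}],\qquad F[\langle E[\mathcal{S}k.t]\rangle]\to F[\langle t\{\lambda x.\langle E[x]\rangle/k\}\rangle]\ (x\notin \mathrm{fv}(E)),\qquad F[\langle V\rangle]\to F[V];$$ $\to^*$ is its reflexive and transitive closure, and $t\Downarrow t'$ means that $t\to^* t'$ and $t'$ is irreducible. **Contextual equivalence for programs.** For (possibly open) terms, $t_0\approx_p t_1$ if for every context $C$ such that $\langle C[t_0]\rangle$ and $\langle C[t_1]\rangle$ are closed, $\langle C[t_0]\rangle\Downarrow V_0$ for some value $V_0$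 if and only if $\langle C[t_1]\rangle\Downarrow V_1$ for some value $V_1$. **Environmental bisimilarity for programs.** An environment $\mathcal{E}$ is a relation on closed values. Let $\widehat{\mathcal{E}}$ be the restriction to closed terms of the smallest relation on terms that contains $\mathcal{E}$, relates every variable to itself, and is compatible with all term constructors. Let $\widetilde{\mathcal{E}}$ be the smallest relation on closed evaluation contexts such that $\square\,\widetilde{\mathcal{E}}\,\square$ and, whenever $F_0\,\widetilde{\mathcal{E}}\,F_1$: $V_0F_0\,\widetilde{\mathcal{E}}\,V_1F_1$ if $V_0\,\widehat{\mathcal{E}}\,V_1$; $F_0t_0\,\widetilde{\mathcal{E}}\,F_1t_1$ if $t_0\,\widehat{\mathcal{E}}\,t_1$; and $\langle F_0\rangle\,\widetilde{\mathcal{E}}\,\langle F_1\rangle$. An environmental relation $\mathcal{X}$ is a set of environments $\mathcal{E}$ and of triples $(\mathcal{E},t_0,t_1)$ with $\mathcal{E}$ an environment and $t_0,t_1$ closed terms; write $t_0\,\mathcal{X}_{\mathcal{E}}\,t_1$ for $(\mathcal{E},t_0,t_1)\in\mathcal{X}$. It is an environmental bisimulation for programs if: 1. if $t_0\,\mathcal{X}_{\mathcal{E}}\,t_1$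 and $t_0,t_1$ are not both programs, then $\langle E_0[t_0]\rangle\,\mathcal{X}_{\mathcal{E}}\,\langle E_1[t_1]\rangle$ for all pure contexts $E_0\,\widetilde{\mathcal{E}}\,E_1$; 2. if $P_0\,\mathcal{X}_{\mathcal{E}}\,P_1$ for programs $P_0,P_1$, then (a) if $P_0\to P_0'$ with $P_0'$ a program, then there is a program $P_1'$ with $P_1\to^*P_1'$ and $P_0'\,\mathcal{X}_{\mathcal{E}}\,P_1'$; (b) if $P_0\to V_0$ with $V_0$ a value, then there is a value $V_1$ with $P_1\to^*V_1$ and $\{(V_0,V_1)\}\cup\mathcal{E}\in\mathcal{X}$; (c) the converses of (a) and (b), for the reductions of $P_1$, hold; 3. if $\mathcal{E}\in\mathcal{X}$, $\lambda x.t_0\,\mathcal{E}\,\lambda x.t_1$ and $V_0\,\widehat{\mathcal{E}}\,V_1$ for values $V_0,V_1$, then $t_0\{V_0/x\}\,\mathcal{X}_{\mathcal{E}}\,t_1\{V_1/x\}$. Environmental bisimilarity for programs is the largest such $\mathcal{X}$ (the union of all of them); write $t_0\simeq_p t_1$ if it contains the triple $(\emptyset,t_0,t_1)$. **Corollary (Soundness).**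 We have $\mathord{\simeq_p}\subseteq\mathord{\approx_p}$: for all terms $t_0,t_1$, if $t_0\simeq_p t_1$ then $t_0\approx_p t_1$. -/

import Mathlib

namespace ShiftReset

/-- Terms of the call-by-value lambda-calculus with shift and reset, up to alpha-conversion
(de Bruijn indices): variables, `λx.t`, application, `𝒮k.t` and `⟨t⟩`.
Both `lam` and `shift` bind the index `0` in their argument. -/
inductive Tm : Type where
  | var (i : ℕ) : Tm
  | lam (t : Tm) : Tm
  | app (s t : Tm) : Tm
  | shift (t : Tm) : Tm
  | reset (t : Tm) : Tm

namespace Tm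

/-- All free indices of the term are smaller than `n`. -/
def ClosedAt : ℕ → Tm → Prop
  | n, var i => i < n
  | n, lam t => ClosedAt (n + 1) t
  | n, app s t => ClosedAt n s ∧ ClosedAt n t
  | n, shift t => ClosedAt (n + 1) t
  | n, reset t => ClosedAt n t

/-- Terms without free variables. -/
def Closed (t : Tm) : Prop := ClosedAt 0 t

/-- Values are the lambda-abstractions. -/
def IsValue (t : Tm) : Prop := ∃ b : Tm, t = lam b

/-- Programs are the terms of the form `⟨t⟩`. -/
def IsProgram (t : Tm) : Prop := ∃ s : Tm, t = reset s

/-- Lifting of a renaming under a binder. -/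
def upRen (f : ℕ → ℕ) : ℕ → ℕ
  | 0 => 0
  | i + 1 => f i + 1

/-- Renaming of the free variables. -/
def rename : (ℕ → ℕ) → Tm → Tm
  | f, var i => var (f i)
  | f, lam t => lam (rename (upRen f) t)
  | f, app s t => app (rename f s) (rename f t)
  | f, shift t => shift (rename (upRen f) t)
  | f, reset t => reset (rename f t)

/-- Lifting of a substitution under a binder. -/
def upSubst (σ : ℕ → Tm) : ℕ → Tm
  | 0 => var 0
  | i + 1 => rename Nat.succ (σ i)

/-- Simultaneous capture-avoiding substitution. -/
def subst : (ℕ → Tm) → Tm → Tm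
  | σ, var i => σ i
  | σ, lam t => lam (subst (upSubst σ) t)
  | σ, app s t => app (subst σ s) (subst σ t)
  | σ, shift t => shift (subst (upSubst σ) t)
  | σ, reset t => reset (subst σ t)

/-- The substitution replacing the index `0` by `v` and lowering the other indices. -/
def single (v : Tm) : ℕ → Tm
  | 0 => v
  | i + 1 => var i

/-- `t{v/x}`, where `x` is the index `0` of `t`. -/
def inst (t v : Tm) : Tm := subst (single v) t

end Tm

/-- Call-by-value evaluation contexts `F ::= □ | v F | F t | ⟨F⟩`, represented outside-in.
`argOf b F` is the context `(λx.b) F`. -/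
inductive ECtx : Type where
  | hole : ECtx
  | argOf (b : Tm) (F : ECtx) : ECtx
  | funOf (F : ECtx) (t : Tm) : ECtx
  | reset (F : ECtx) : ECtx

namespace ECtx

/-- Filling of an evaluation context (these contexts bind no variable). -/
def fill : ECtx → Tm → Tm
  | hole, t => t
  | argOf b F, t => Tm.app (Tm.lam b) (F.fill t)
  | funOf F s, t => Tm.app (F.fill t) s
  | reset F, t => Tm.reset (F.fill t)

/-- Pure contexts `E ::= □ | v E | E t` are the evaluation contexts without reset. -/
def IsPure : ECtx → Prop
  | hole => True
  | argOf _ F => F.IsPure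
  | funOf F _ => F.IsPure
  | reset _ => False

/-- Renaming of the free variables of an evaluation context. -/
def rename (f : ℕ → ℕ) : ECtx → ECtx
  | hole => hole
  | argOf b F => argOf (Tm.rename (Tm.upRen f) b) (F.rename f)
  | funOf F s => funOf (F.rename f) (Tm.rename f s)
  | reset F => reset (F.rename f)

end ECtx

/-- Arbitrary one-hole contexts. -/
inductive Ctx : Type where
  | hole : Ctx
  | lam (C : Ctx) : Ctx
  | argOf (t : Tm) (C : Ctx) : Ctx
  | funOf (C : Ctx) (t : Tm) : Ctx
  | shift (C : Ctx) : Ctx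
  | reset (C : Ctx) : Ctx

/-- Filling of a context. Indices are not shifted: the free variables of the term
may be captured by the binders above the hole. -/
def Ctx.fill : Ctx → Tm → Tm
  | Ctx.hole, t => t
  | Ctx.lam C, t => Tm.lam (C.fill t)
  | Ctx.argOf s C, t => Tm.app s (C.fill t)
  | Ctx.funOf C s, t => Tm.app (C.fill t) s
  | Ctx.shift C, t => Tm.shift (C.fill t)
  | Ctx.reset C, t => Tm.reset (C.fill t)

/-- The continuation `λx.⟨E[x]⟩`, with `x` not free in `E`. -/
def captured (E : ECtx) : Tm :=
  Tm.lam (Tm.reset ((E.rename Nat.succ).fill (Tm.var 0)))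

/-- The call-by-value reduction relation. -/
inductive Step : Tm → Tm → Prop where
  | beta (F : ECtx) (t v : Tm) (hv : v.IsValue) :
      Step (F.fill (Tm.app (Tm.lam t) v)) (F.fill (t.inst v))
  | shift (F E : ECtx) (t : Tm) (hE : E.IsPure) :
      Step (F.fill (Tm.reset (E.fill (Tm.shift t))))
        (F.fill (Tm.reset (t.inst (captured E))))
  | reset (F : ECtx) (v : Tm) (hv : v.IsValue) :
      Step (F.fill (Tm.reset v)) (F.fill v)

/-- The reflexive and transitive closure of the reduction relation. -/
def Steps : Tm → Tm → Prop := Relation.ReflTransGen Step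

/-- `t` evaluates to `t'`. -/
def Evaluates (t t' : Tm) : Prop := Steps t t' ∧ ∀ t'', ¬ Step t' t''

/-- `t` evaluates to some value. -/
def EvaluatesToValue (t : Tm) : Prop := ∃ v : Tm, v.IsValue ∧ Evaluates t v

/-- Contextual equivalence for the original semantics: terms, possibly open, are tested
inside closing contexts surrounded by a top-level reset. -/
def CtxEquiv (t₀ t₁ : Tm) : Prop :=
  ∀ C : Ctx, (Tm.reset (C.fill t₀)).Closed → (Tm.reset (C.fill t₁)).Closed →
    (EvaluatesToValue (Tm.reset (C.fill t₀)) → EvaluatesToValue (Tm.reset (C.fill t₁))) ∧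
    (EvaluatesToValue (Tm.reset (C.fill t₁)) → EvaluatesToValue (Tm.reset (C.fill t₀)))

/-- The term-generating closure of a relation, on possibly open terms. -/
inductive TmClosure (R : Set (Tm × Tm)) : Tm → Tm → Prop where
  | base {t t' : Tm} : (t, t') ∈ R → TmClosure R t t'
  | var (i : ℕ) : TmClosure R (Tm.var i) (Tm.var i)
  | lam {t t' : Tm} : TmClosure R t t' → TmClosure R (Tm.lam t) (Tm.lam t')
  | app {s s' t t' : Tm} : TmClosure R s s' → TmClosure R t t' →
      TmClosure R (Tm.app s t) (Tm.app s' t')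
  | shift {t t' : Tm} : TmClosure R t t' → TmClosure R (Tm.shift t) (Tm.shift t')
  | reset {t t' : Tm} : TmClosure R t t' → TmClosure R (Tm.reset t) (Tm.reset t')

/-- The restriction of the term-generating closure to closed terms. -/
def ClosedTmClosure (R : Set (Tm × Tm)) (t t' : Tm) : Prop :=
  TmClosure R t t' ∧ t.Closed ∧ t'.Closed

/-- The context-generating closure of a relation, on closed evaluation contexts. -/
inductive ECtxClosure (R : Set (Tm × Tm)) : ECtx → ECtx → Prop where
  | hole : ECtxClosure R ECtx.hole ECtx.hole
  | argOf {b₀ b₁ : Tm} {F₀ F₁ : ECtx} : ECtxClosure R F₀ F₁ →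
      ClosedTmClosure R (Tm.lam b₀) (Tm.lam b₁) →
      ECtxClosure R (ECtx.argOf b₀ F₀) (ECtx.argOf b₁ F₁)
  | funOf {F₀ F₁ : ECtx} {t₀ t₁ : Tm} : ECtxClosure R F₀ F₁ → ClosedTmClosure R t₀ t₁ →
      ECtxClosure R (ECtx.funOf F₀ t₀) (ECtx.funOf F₁ t₁)
  | reset {F₀ F₁ : ECtx} : ECtxClosure R F₀ F₁ →
      ECtxClosure R (ECtx.reset F₀) (ECtx.reset F₁)

/-- Environments are the relations on closed values. -/
def IsEnvironment (Γ : Set (Tm × Tm)) : Prop :=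
  ∀ p ∈ Γ, p.1.IsValue ∧ p.1.Closed ∧ p.2.IsValue ∧ p.2.Closed

/-- An environmental relation is a set of environments `Γ` together with a set of triples
`(Γ, t₀, t₁)`, where `Γ` is an environment and `t₀`, `t₁` are closed terms. -/
structure EnvRel where
  envs : Set (Set (Tm × Tm))
  rel : Set (Tm × Tm) → Tm → Tm → Prop
  envs_env : ∀ Γ ∈ envs, IsEnvironment Γ
  rel_env : ∀ Γ t₀ t₁, rel Γ t₀ t₁ → IsEnvironment Γ
  rel_closed : ∀ Γ t₀ t₁, rel Γ t₀ t₁ → t₀.Closed ∧ t₁.Closed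

/-- Environmental bisimulations for programs. -/
structure IsEnvBisim (X : EnvRel) : Prop where
  /-- terms that are not both programs are tested in related delimited pure contexts -/
  nonprogram : ∀ Γ t₀ t₁, X.rel Γ t₀ t₁ → ¬ (t₀.IsProgram ∧ t₁.IsProgram) →
    ∀ E₀ E₁ : ECtx, E₀.IsPure → E₁.IsPure → ECtxClosure Γ E₀ E₁ →
      X.rel Γ (Tm.reset (E₀.fill t₀)) (Tm.reset (E₁.fill t₁))
  step_left : ∀ Γ p₀ p₁, X.rel Γ p₀ p₁ → p₀.IsProgram → p₁.IsProgram →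
    ∀ p₀' : Tm, p₀'.IsProgram → Step p₀ p₀' →
      ∃ p₁' : Tm, p₁'.IsProgram ∧ Steps p₁ p₁' ∧ X.rel Γ p₀' p₁'
  value_left : ∀ Γ p₀ p₁, X.rel Γ p₀ p₁ → p₀.IsProgram → p₁.IsProgram →
    ∀ v₀ : Tm, v₀.IsValue → Step p₀ v₀ →
      ∃ v₁ : Tm, v₁.IsValue ∧ Steps p₁ v₁ ∧ {(v₀, v₁)} ∪ Γ ∈ X.envs
  step_right : ∀ Γ p₀ p₁, X.rel Γ p₀ p₁ → p₀.IsProgram → p₁.IsProgram →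
    ∀ p₁' : Tm, p₁'.IsProgram → Step p₁ p₁' →
      ∃ p₀' : Tm, p₀'.IsProgram ∧ Steps p₀ p₀' ∧ X.rel Γ p₀' p₁'
  value_right : ∀ Γ p₀ p₁, X.rel Γ p₀ p₁ → p₀.IsProgram → p₁.IsProgram →
    ∀ v₁ : Tm, v₁.IsValue → Step p₁ v₁ →
      ∃ v₀ : Tm, v₀.IsValue ∧ Steps p₀ v₀ ∧ {(v₀, v₁)} ∪ Γ ∈ X.envs
  /-- related abstractions are tested with related arguments built from the environment -/
  env : ∀ Γ ∈ X.envs, ∀ b₀ b₁ : Tm, (Tm.lam b₀, Tm.lam b₁) ∈ Γ →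
    ∀ v₀ v₁ : Tm, v₀.IsValue → v₁.IsValue → ClosedTmClosure Γ v₀ v₁ →
      X.rel Γ (b₀.inst v₀) (b₁.inst v₁)

/-- Environmental bisimilarity for programs: the union of all environmental bisimulations
for programs, which is the largest one. -/
def envBisimilarity : EnvRel where
  envs := {Γ | ∃ X : EnvRel, IsEnvBisim X ∧ Γ ∈ X.envs}
  rel Γ t₀ t₁ := ∃ X : EnvRel, IsEnvBisim X ∧ X.rel Γ t₀ t₁
  envs_env := fun Γ ⟨X, _, h⟩ => X.envs_env Γ h
  rel_env := fun Γ t₀ t₁ ⟨X, _, h⟩ => X.rel_env Γ t₀ t₁ h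
  rel_closed := fun Γ t₀ t₁ ⟨X, _, h⟩ => X.rel_closed Γ t₀ t₁ h

theorem envBisimilarity_isEnvBisim : IsEnvBisim envBisimilarity where
  nonprogram := fun Γ t₀ t₁ ⟨X, hX, h⟩ hn E₀ E₁ h₀ h₁ hE =>
    ⟨X, hX, hX.nonprogram Γ t₀ t₁ h hn E₀ E₁ h₀ h₁ hE⟩
  step_left := fun Γ p₀ p₁ ⟨X, hX, h⟩ h₀ h₁ p hp hs =>
    let ⟨q, hq, hqs, hr⟩ := hX.step_left Γ p₀ p₁ h h₀ h₁ p hp hs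
    ⟨q, hq, hqs, X, hX, hr⟩
  value_left := fun Γ p₀ p₁ ⟨X, hX, h⟩ h₀ h₁ v hv hs =>
    let ⟨q, hq, hqs, hr⟩ := hX.value_left Γ p₀ p₁ h h₀ h₁ v hv hs
    ⟨q, hq, hqs, X, hX, hr⟩
  step_right := fun Γ p₀ p₁ ⟨X, hX, h⟩ h₀ h₁ p hp hs =>
    let ⟨q, hq, hqs, hr⟩ := hX.step_right Γ p₀ p₁ h h₀ h₁ p hp hs
    ⟨q, hq, hqs, X, hX, hr⟩
  value_right := fun Γ p₀ p₁ ⟨X, hX, h⟩ h₀ h₁ v hv hs =>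
    let ⟨q, hq, hqs, hr⟩ := hX.value_right Γ p₀ p₁ h h₀ h₁ v hv hs
    ⟨q, hq, hqs, X, hX, hr⟩
  env := fun Γ ⟨X, hX, h⟩ b₀ b₁ hb v₀ v₁ h₀ h₁ hv =>
    ⟨X, hX, hX.env Γ h b₀ b₁ hb v₀ v₁ h₀ h₁ hv⟩

/-- Two terms are bisimilar when they are related by environmental bisimilarity for programs
under the empty environment (this forces them to be closed). -/
def Bisimilar (t₀ t₁ : Tm) : Prop := envBisimilarity.rel ∅ t₀ t₁

end ShiftReset

/-!
A relation between terms is followed along the reductions of its left-hand side.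

Bisimilar terms `t₀`, `t₁` are first shown to co-terminate in every closed *evaluation* context
below a top-level reset (`IsEnvBisim.obsLE`). Cut such a context at its innermost reset: the
bisimulation relates the two programs that are formed there, and plays the reduction of the left
one against the right one until both become values `v₀`, `v₁`. The pair `(v₀, v₁)` then joins the
environment, and what remains are two terms built from the extended environment `Γ`. They reduce in
lockstep, except when an abstraction of `Γ` is applied; clause 3 of the definition then relates the
contracta, and the innermost reset around them yields related programs again. One induction on
the length of the left-hand reduction covers both situations (`IsEnvBisim.terminates_aux`).

Passing from evaluation contexts to arbitrary contexts needs no further bisimulation. As `t₀` and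
`t₁` are closed, the two filled contexts differ only in that some occurrences of `t₀` are replaced
by `t₁`, and this is preserved by substitution. Whenever such an occurrence reaches an
evaluation position on the right, the first part allows `t₁` to be exchanged for `t₀` there, after
which both sides make the same step (`terminates_of_tmClosure_singleton`).

Both arguments rest on the same analysis of a reduction step of `T` when `T` and `T'` are related by
the closure of `R` (`UpTo.simulation`): `T'` makes a matching step up to a preorder `O`, unless an
abstraction related by `R` itself is applied. In the first argument `O` is equality and `R` an
environment; in the second `O` is the observational preorder `ObsLE` and `R = {(t₀, t₁)}`.
-/

namespace ShiftReset

/-! ### Renaming and substitution of closed terms -/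

namespace Tm

theorem rename_eq_self {t : Tm} {n : ℕ} (ht : t.ClosedAt n) {f : ℕ → ℕ}
    (hf : ∀ i < n, f i = i) : t.rename f = t := by
  induction t generalizing n f with
  | var i => simp [rename, hf i ht]
  | lam t ih | shift t ih =>
    simp only [rename]
    rw [ih (n := n + 1) ht]
    rintro (_ | i) hi
    · rfl
    · simp [upRen, hf i (by omega)]
  | app s t ihs iht => simp [rename, ihs ht.1 hf, iht ht.2 hf]
  | reset t ih => simp only [rename]; rw [ih ht hf]

theorem subst_eq_self {t : Tm} {n : ℕ} (ht : t.ClosedAt n) {σ : ℕ → Tm}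
    (hσ : ∀ i < n, σ i = var i) : t.subst σ = t := by
  induction t generalizing n σ with
  | var i => simp [subst, hσ i ht]
  | lam t ih | shift t ih =>
    simp only [subst]
    rw [ih (n := n + 1) ht]
    rintro (_ | i) hi
    · rfl
    · simp [upSubst, hσ i (by omega), rename]
  | app s t ihs iht => simp [subst, ihs ht.1 hσ, iht ht.2 hσ]
  | reset t ih => simp only [subst]; rw [ih ht hσ]

theorem Closed.rename_eq {t : Tm} (ht : t.Closed) (f : ℕ → ℕ) : t.rename f = t :=
  rename_eq_self ht (by simp)

theorem Closed.subst_eq {t : Tm} (ht : t.Closed) (σ : ℕ → Tm) : t.subst σ = t :=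
  subst_eq_self ht (by simp)

theorem ClosedAt.rename {t : Tm} {n m : ℕ} (ht : t.ClosedAt n) {f : ℕ → ℕ}
    (hf : ∀ i < n, f i < m) : (t.rename f).ClosedAt m := by
  induction t generalizing n m f with
  | var i => exact hf i ht
  | lam t ih | shift t ih =>
    refine ih (n := n + 1) (m := m + 1) ht ?_
    rintro (_ | i) hi
    · simp [upRen]
    · simpa [upRen] using hf i (by omega)
  | app s t ihs iht => exact ⟨ihs ht.1 hf, iht ht.2 hf⟩
  | reset t ih => exact ih (n := n) (m := m) ht hf

theorem ClosedAt.subst {t : Tm} {n m : ℕ} (ht : t.ClosedAt n) {σ : ℕ → Tm}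
    (hσ : ∀ i < n, (σ i).ClosedAt m) : (t.subst σ).ClosedAt m := by
  induction t generalizing n m σ with
  | var i => exact hσ i ht
  | lam t ih | shift t ih =>
    refine ih (n := n + 1) (m := m + 1) ht ?_
    rintro (_ | i) hi
    · simp [upSubst, ClosedAt]
    · exact (hσ i (by omega)).rename (by simp)
  | app s t ihs iht => exact ⟨ihs ht.1 hσ, iht ht.2 hσ⟩
  | reset t ih => exact ih (n := n) (m := m) ht hσ

theorem ClosedAt.inst {t v : Tm} (ht : t.ClosedAt 1) (hv : v.Closed) : (t.inst v).Closed := by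
  refine ClosedAt.subst ht ?_
  rintro (_ | i) hi
  · exact hv
  · omega

end Tm

/-! ### Evaluation contexts -/

namespace ECtx

/-- Composition: `(G.comp F).fill t = G.fill (F.fill t)`. -/
def comp : ECtx → ECtx → ECtx
  | hole, F => F
  | argOf b G, F => argOf b (G.comp F)
  | funOf G s, F => funOf (G.comp F) s
  | reset G, F => reset (G.comp F)

/-- Evaluation contexts without free variables. -/
def Closed : ECtx → Prop
  | hole => True
  | argOf b F => (Tm.lam b).Closed ∧ F.Closed
  | funOf F s => F.Closed ∧ s.Closed
  | reset F => F.Closed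

theorem fill_comp (G F : ECtx) (t : Tm) : (G.comp F).fill t = G.fill (F.fill t) := by
  induction G <;> simp_all [comp, fill]

theorem Closed.comp {G F : ECtx} (hG : G.Closed) (hF : F.Closed) : (G.comp F).Closed := by
  induction G with
  | hole => exact hF
  | argOf b G ih => exact ⟨hG.1, ih hG.2⟩
  | funOf G s ih => exact ⟨ih hG.1, hG.2⟩
  | reset G ih => exact ih hG

theorem Closed.fill {F : ECtx} (hF : F.Closed) {t : Tm} (ht : t.Closed) :
    (F.fill t).Closed := by
  induction F with
  | hole => exact ht
  | argOf b F ih => exact ⟨hF.1, ih hF.2⟩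
  | funOf F s ih => exact ⟨ih hF.1, hF.2⟩
  | reset F ih => exact ih hF

theorem Closed.fill_rename {F : ECtx} (hF : F.Closed) (f : ℕ → ℕ) {t : Tm} {n : ℕ}
    (ht : t.ClosedAt n) : ((F.rename f).fill t).ClosedAt n := by
  have key : ∀ s : Tm, s.Closed → (s.rename f).ClosedAt n := fun s hs =>
    Tm.ClosedAt.rename (n := 0) hs (by simp)
  induction F with
  | hole => exact ht
  | argOf b F ih => exact ⟨key _ hF.1, ih hF.2⟩
  | funOf F s ih => exact ⟨ih hF.1, key _ hF.2⟩
  | reset F ih => exact ih hF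

theorem Closed.captured {E : ECtx} (hE : E.Closed) : (captured E).Closed :=
  hE.fill_rename (n := 1) Nat.succ (t := Tm.var 0) Nat.one_pos

theorem fill_reset_ne_lam (G : ECtx) (s b : Tm) : G.fill (Tm.reset s) ≠ Tm.lam b := by
  cases G <;> simp [fill]

/-- A control-stuck term has no reset at an evaluation position. -/
theorem fill_reset_ne_fill_shift (G : ECtx) {E : ECtx} (hE : E.IsPure) (s u : Tm) :
    G.fill (Tm.reset s) ≠ E.fill (Tm.shift u) := by
  induction G generalizing E with
  | hole => cases E <;> simp [fill, IsPure] at hE ⊢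
  | argOf b G ih =>
    cases E with
    | funOf E r => cases E <;> simp [fill, IsPure] at hE ⊢
    | argOf c E => simpa [fill] using fun _ => ih (E := E) hE
    | _ => simp [fill, IsPure] at hE ⊢
  | funOf G r ih =>
    cases E with
    | funOf E r' => simpa [fill] using fun h => absurd h (ih (E := E) hE)
    | argOf c E => simpa [fill] using fun h => absurd h (fill_reset_ne_lam G s c)
    | _ => simp [fill, IsPure] at hE ⊢
  | reset G ih => cases E <;> simp [fill, IsPure] at hE ⊢

end ECtx

/-! ### Reduction -/

/-- Contraction of a redex, without a surrounding evaluation context. -/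
inductive HeadStep : Tm → Tm → Prop where
  | beta (b c : Tm) : HeadStep (Tm.app (Tm.lam b) (Tm.lam c)) (b.inst (Tm.lam c))
  | shift (E : ECtx) (t : Tm) (hE : E.IsPure) :
      HeadStep (Tm.reset (E.fill (Tm.shift t))) (Tm.reset (t.inst (captured E)))
  | reset (b : Tm) : HeadStep (Tm.reset (Tm.lam b)) (Tm.lam b)

theorem step_iff_headStep {T T₁ : Tm} :
    Step T T₁ ↔ ∃ F r r₁, HeadStep r r₁ ∧ T = ECtx.fill F r ∧ T₁ = ECtx.fill F r₁ := by
  constructor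
  · rintro (⟨F, t, v, ⟨c, rfl⟩⟩ | ⟨F, E, t, hE⟩ | ⟨F, v, ⟨b, rfl⟩⟩)
    · exact ⟨F, _, _, .beta _ _, rfl, rfl⟩
    · exact ⟨F, _, _, .shift _ _ hE, rfl, rfl⟩
    · exact ⟨F, _, _, .reset _, rfl, rfl⟩
  · rintro ⟨F, r, r₁, ⟨b, c⟩ | ⟨E, t, hE⟩ | ⟨b⟩, rfl, rfl⟩
    · exact .beta F _ _ ⟨c, rfl⟩
    · exact .shift F E t hE
    · exact .reset F _ ⟨b, rfl⟩

theorem Step.fill {s s' : Tm} (h : Step s s') (F : ECtx) : Step (F.fill s) (F.fill s') := by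
  obtain ⟨G, r, r₁, hr, rfl, rfl⟩ := step_iff_headStep.1 h
  exact step_iff_headStep.2
    ⟨F.comp G, r, r₁, hr, (ECtx.fill_comp ..).symm, (ECtx.fill_comp ..).symm⟩

theorem Steps.fill {s s' : Tm} (h : Steps s s') (F : ECtx) : Steps (F.fill s) (F.fill s') :=
  Relation.ReflTransGen.lift F.fill (fun _ _ (h : Step _ _) => h.fill F) _ _ h

theorem not_step_lam (b T : Tm) : ¬ Step (Tm.lam b) T := by
  intro h
  obtain ⟨F, r, r₁, hr, h₁, -⟩ := step_iff_headStep.1 h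
  cases F <;> simp [ECtx.fill] at h₁
  subst h₁
  cases hr

theorem step_app_inv {s t x : Tm} (h : Step (Tm.app s t) x) :
    (∃ s', Step s s' ∧ x = Tm.app s' t) ∨
    (∃ b t', s = Tm.lam b ∧ Step t t' ∧ x = Tm.app s t') ∨
    (∃ b c, s = Tm.lam b ∧ t = Tm.lam c) := by
  obtain ⟨F, r, r₁, hr, h₁, rfl⟩ := step_iff_headStep.1 h
  cases F <;> simp [ECtx.fill] at h₁
  case hole =>
    subst h₁
    cases hr
    exact .inr (.inr ⟨_, _, rfl, rfl⟩)
  case argOf b F =>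
    obtain ⟨rfl, rfl⟩ := h₁
    exact .inr (.inl ⟨b, _, rfl, step_iff_headStep.2 ⟨F, r, r₁, hr, rfl, rfl⟩, rfl⟩)
  case funOf F u =>
    obtain ⟨rfl, rfl⟩ := h₁
    exact .inl ⟨_, step_iff_headStep.2 ⟨F, r, r₁, hr, rfl, rfl⟩, rfl⟩

theorem step_reset_inv {t x : Tm} (h : Step (Tm.reset t) x) :
    (∃ t', Step t t' ∧ x = Tm.reset t') ∨
    (∃ E u, ECtx.IsPure E ∧ t = E.fill (Tm.shift u) ∧ x = Tm.reset (u.inst (captured E))) ∨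
    (∃ b, t = Tm.lam b ∧ x = Tm.lam b) := by
  obtain ⟨F, r, r₁, hr, h₁, rfl⟩ := step_iff_headStep.1 h
  cases F <;> simp [ECtx.fill] at h₁
  case hole =>
    subst h₁
    cases hr with
    | shift E u hE => exact .inr (.inl ⟨E, u, hE, rfl, rfl⟩)
    | reset b => exact .inr (.inr ⟨b, rfl, rfl⟩)
  case reset F =>
    subst h₁
    exact .inl ⟨_, step_iff_headStep.2 ⟨F, r, r₁, hr, rfl, rfl⟩, rfl⟩

/-- A program at an evaluation position is where the reduction takes place. -/
theorem step_fill_reset_inv {G : ECtx} {s x : Tm} (h : Step (G.fill (Tm.reset s)) x) :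
    ∃ q, Step (Tm.reset s) q ∧ x = G.fill q := by
  induction G generalizing x with
  | hole => exact ⟨x, h, rfl⟩
  | argOf b G ih =>
    rcases step_app_inv h with ⟨s', hs, -⟩ | ⟨_, t', -, ht, rfl⟩ | ⟨_, c, -, hc⟩
    · exact absurd hs (not_step_lam _ _)
    · obtain ⟨q, hq, rfl⟩ := ih ht
      exact ⟨q, hq, rfl⟩
    · exact absurd hc (G.fill_reset_ne_lam _ _)
  | funOf G u ih =>
    rcases step_app_inv h with ⟨s', hs, rfl⟩ | ⟨b, t', hb, -⟩ | ⟨b, c, hb, -⟩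
    · obtain ⟨q, hq, rfl⟩ := ih hs
      exact ⟨q, hq, rfl⟩
    all_goals exact absurd hb (G.fill_reset_ne_lam _ _)
  | reset G ih =>
    rcases step_reset_inv h with ⟨t', ht, rfl⟩ | ⟨E, u, hE, hu, -⟩ | ⟨b, hb, -⟩
    · obtain ⟨q, hq, rfl⟩ := ih ht
      exact ⟨q, hq, rfl⟩
    · exact absurd hu (G.fill_reset_ne_fill_shift hE _ _)
    · exact absurd hb (G.fill_reset_ne_lam _ _)

/-- Being a program or a value is an invariant of reduction, while a reduction from an arbitrary
term need not pass through programs. -/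
theorem isProgram_or_isValue_of_step {T T₁ : Tm} (hT : T.IsProgram ∨ T.IsValue)
    (h : Step T T₁) : T₁.IsProgram ∨ T₁.IsValue := by
  rcases hT with ⟨s, rfl⟩ | ⟨b, rfl⟩
  · rcases step_reset_inv h with ⟨t', -, rfl⟩ | ⟨E, u, -, -, rfl⟩ | ⟨b, -, rfl⟩
    · exact .inl ⟨_, rfl⟩
    · exact .inl ⟨_, rfl⟩
    · exact .inr ⟨_, rfl⟩
  · exact absurd h (not_step_lam _ _)

/-- The term reduces to a value. -/
def Terminates (t : Tm) : Prop := ∃ b, Steps t (Tm.lam b)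

theorem evaluatesToValue_iff {t : Tm} : EvaluatesToValue t ↔ Terminates t := by
  constructor
  · rintro ⟨_, ⟨b, rfl⟩, h, -⟩
    exact ⟨b, h⟩
  · rintro ⟨b, h⟩
    exact ⟨_, ⟨b, rfl⟩, h, not_step_lam b⟩

theorem terminates_lam (b : Tm) : Terminates (Tm.lam b) := ⟨b, .refl⟩

theorem Terminates.of_steps {t t' : Tm} (h : Steps t t') (h' : Terminates t') :
    Terminates t := h'.imp fun _ h' => h.trans h'

theorem Terminates.of_reset_reset {s : Tm} (h : Terminates (Tm.reset (Tm.reset s))) :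
    Terminates (Tm.reset s) := by
  obtain ⟨b, h⟩ := h
  generalize hT : Tm.reset (Tm.reset s) = T at h
  induction h using Relation.ReflTransGen.head_induction_on generalizing s with
  | refl => cases hT
  | head h₁ h₂ ih =>
    subst hT
    obtain ⟨q, hq, rfl⟩ := step_fill_reset_inv (G := .reset .hole) h₁
    rcases isProgram_or_isValue_of_step (.inl ⟨_, rfl⟩) hq with ⟨s', rfl⟩ | ⟨c, rfl⟩
    · exact (ih rfl).of_steps (.single hq)
    · exact ⟨c, .single hq⟩

/-! ### Closures of a relation -/

theorem TmClosure.refl (R : Set (Tm × Tm)) (t : Tm) : TmClosure R t t := by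
  induction t with
  | var i => exact .var i
  | lam t ih => exact .lam ih
  | app s t ihs iht => exact .app ihs iht
  | shift t ih => exact .shift ih
  | reset t ih => exact .reset ih

theorem TmClosure.ctxFill {R : Set (Tm × Tm)} {t t' : Tm} (h : TmClosure R t t') (C : Ctx) :
    TmClosure R (C.fill t) (C.fill t') := by
  induction C with
  | hole => exact h
  | lam C ih => exact .lam ih
  | argOf s C ih => exact .app (.refl R s) ih
  | funOf C s ih => exact .app ih (.refl R s)
  | shift C ih => exact .shift ih
  | reset C ih => exact .reset ih

theorem TmClosure.mono {R S : Set (Tm × Tm)} (hRS : R ⊆ S) {t t' : Tm}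
    (h : TmClosure R t t') : TmClosure S t t' := by
  induction h with
  | base h => exact .base (hRS h)
  | var i => exact .var i
  | lam _ ih => exact .lam ih
  | app _ _ ihs iht => exact .app ihs iht
  | shift _ ih => exact .shift ih
  | reset _ ih => exact .reset ih

theorem ECtxClosure.mono {R S : Set (Tm × Tm)} (hRS : R ⊆ S) {F F' : ECtx}
    (h : ECtxClosure R F F') : ECtxClosure S F F' := by
  induction h with
  | hole => exact .hole
  | argOf _ hb ih => exact .argOf ih ⟨hb.1.mono hRS, hb.2⟩
  | funOf _ ht ih => exact .funOf ih ⟨ht.1.mono hRS, ht.2⟩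
  | reset _ ih => exact .reset ih

theorem ECtxClosure.refl (R : Set (Tm × Tm)) {F : ECtx} (hF : F.Closed) :
    ECtxClosure R F F := by
  induction F with
  | hole => exact .hole
  | argOf b F ih => exact .argOf (ih hF.2) ⟨.refl R _, hF.1, hF.1⟩
  | funOf F s ih => exact .funOf (ih hF.1) ⟨.refl R _, hF.2, hF.2⟩
  | reset F ih => exact .reset (ih hF)

theorem ECtxClosure.closed {R : Set (Tm × Tm)} {F F' : ECtx} (h : ECtxClosure R F F') :
    F.Closed ∧ F'.Closed := by
  induction h with
  | hole => exact ⟨trivial, trivial⟩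
  | argOf _ hb ih => exact ⟨⟨hb.2.1, ih.1⟩, ⟨hb.2.2, ih.2⟩⟩
  | funOf _ ht ih => exact ⟨⟨ih.1, ht.2.1⟩, ⟨ih.2, ht.2.2⟩⟩
  | reset _ ih => exact ih

theorem ECtxClosure.isPure {R : Set (Tm × Tm)} {F F' : ECtx} (h : ECtxClosure R F F')
    (hF : F.IsPure) : F'.IsPure := by
  induction h with
  | hole => trivial
  | argOf _ _ ih => exact ih hF
  | funOf _ _ ih => exact ih hF
  | reset _ _ => exact hF.elim

theorem ECtxClosure.fill {R : Set (Tm × Tm)} {F F' : ECtx} (h : ECtxClosure R F F')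
    {t t' : Tm} (ht : ClosedTmClosure R t t') :
    ClosedTmClosure R (F.fill t) (F'.fill t') := by
  refine ⟨?_, h.closed.1.fill ht.2.1, h.closed.2.fill ht.2.2⟩
  induction h with
  | hole => exact ht.1
  | argOf _ hb ih => exact .app hb.1 ih
  | funOf _ hs ih => exact .app ih hs.1
  | reset _ ih => exact .reset ih

/-- Related contexts that contain a reset can be cut at their innermost resets. -/
theorem ECtxClosure.exists_innermost_reset {R : Set (Tm × Tm)} {F F' : ECtx}
    (h : ECtxClosure R F F') (hF : ¬ F.IsPure) :
    ∃ G G' E E', ECtxClosure R G G' ∧ ECtxClosure R E E' ∧ E.IsPure ∧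
      (∀ t, F.fill t = G.fill (Tm.reset (E.fill t))) ∧
      (∀ t, F'.fill t = G'.fill (Tm.reset (E'.fill t))) := by
  induction h with
  | hole => exact absurd trivial hF
  | argOf _ hb ih =>
    obtain ⟨G, G', E, E', hG, hE, hp, h₀, h₁⟩ := ih hF
    exact ⟨_, _, E, E', .argOf hG hb, hE, hp, by simp [ECtx.fill, h₀], by simp [ECtx.fill, h₁]⟩
  | funOf _ hb ih =>
    obtain ⟨G, G', E, E', hG, hE, hp, h₀, h₁⟩ := ih hF
    exact ⟨_, _, E, E', .funOf hG hb, hE, hp, by simp [ECtx.fill, h₀], by simp [ECtx.fill, h₁]⟩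
  | @reset F F' h ih =>
    by_cases hp : F.IsPure
    · exact ⟨_, _, F, F', .hole, h, hp, fun _ => rfl, fun _ => rfl⟩
    · obtain ⟨G, G', E, E', hG, hE, hp, h₀, h₁⟩ := ih hp
      exact ⟨_, _, E, E', .reset hG, hE, hp, by simp [ECtx.fill, h₀], by simp [ECtx.fill, h₁]⟩

/-- A relation on closed terms. -/
def IsClosedRel (R : Set (Tm × Tm)) : Prop := ∀ p ∈ R, p.1.Closed ∧ p.2.Closed

theorem TmClosure.rename {R : Set (Tm × Tm)} (hR : IsClosedRel R) {t t' : Tm}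
    (h : TmClosure R t t') (f : ℕ → ℕ) : TmClosure R (t.rename f) (t'.rename f) := by
  induction h generalizing f with
  | base h =>
    rw [(hR _ h).1.rename_eq, (hR _ h).2.rename_eq]
    exact .base h
  | var i => exact .var _
  | lam _ ih => exact .lam (ih _)
  | app _ _ ihs iht => exact .app (ihs f) (iht f)
  | shift _ ih => exact .shift (ih _)
  | reset _ ih => exact .reset (ih f)

theorem TmClosure.subst {R : Set (Tm × Tm)} (hR : IsClosedRel R) {t t' : Tm}
    (h : TmClosure R t t') {σ σ' : ℕ → Tm} (hσ : ∀ i, TmClosure R (σ i) (σ' i)) :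
    TmClosure R (t.subst σ) (t'.subst σ') := by
  have up : ∀ {σ σ' : ℕ → Tm}, (∀ i, TmClosure R (σ i) (σ' i)) →
      ∀ i, TmClosure R (Tm.upSubst σ i) (Tm.upSubst σ' i) := by
    rintro σ σ' h (_ | i)
    · exact .var 0
    · exact (h i).rename hR _
  induction h generalizing σ σ' with
  | base h =>
    rw [(hR _ h).1.subst_eq, (hR _ h).2.subst_eq]
    exact .base h
  | var i => exact hσ i
  | lam _ ih => exact .lam (ih (up hσ))
  | app _ _ ihs iht => exact .app (ihs hσ) (iht hσ)
  | shift _ ih => exact .shift (ih (up hσ))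
  | reset _ ih => exact .reset (ih hσ)

theorem TmClosure.inst {R : Set (Tm × Tm)} (hR : IsClosedRel R) {t t' v v' : Tm}
    (h : TmClosure R t t') (hv : TmClosure R v v') :
    TmClosure R (t.inst v) (t'.inst v') := by
  refine h.subst hR ?_
  rintro (_ | i)
  · exact hv
  · exact .var i

theorem ECtxClosure.captured {R : Set (Tm × Tm)} (hR : IsClosedRel R) {E E' : ECtx}
    (h : ECtxClosure R E E') : ClosedTmClosure R (captured E) (captured E') := by
  refine ⟨.lam (.reset ?_), h.closed.1.captured, h.closed.2.captured⟩
  induction h with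
  | hole => exact .var 0
  | argOf _ hb ih => exact .app (hb.1.rename hR _) ih
  | funOf _ hs ih => exact .app ih (hs.1.rename hR _)
  | reset _ ih => exact .reset ih

/-! ### Simulation up to a preorder -/

/-- The preorder `O`, compatible with closed evaluation contexts, absorbs the differences between
the terms related by `R`, except for those between two values. -/
structure UpTo (R : Set (Tm × Tm)) (O : Tm → Tm → Prop) : Prop where
  closedRel : IsClosedRel R
  refl : ∀ t, O t t
  trans : ∀ {s t u}, O s t → O t u → O s u
  fill : ∀ {F : ECtx} {s t}, F.Closed → O s t → O (F.fill s) (F.fill t)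
  base : ∀ {t t'}, (t, t') ∈ R → (t.IsValue ∧ t'.IsValue) ∨ O t t'

namespace UpTo

variable {R : Set (Tm × Tm)} {O : Tm → Tm → Prop}

theorem lam_inv (hO : UpTo R O) {b T' : Tm} (h : ClosedTmClosure R (Tm.lam b) T') :
    ∃ b', ClosedTmClosure R (Tm.lam b) (Tm.lam b') ∧ O (Tm.lam b') T' := by
  obtain ⟨h, hc, hc'⟩ := h
  cases h with
  | base h =>
    rcases hO.base h with ⟨-, b', rfl⟩ | h
    · exact ⟨b', ⟨.base h, hc, hc'⟩, hO.refl _⟩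
    · exact ⟨b, ⟨.refl R _, hc, hc⟩, h⟩
  | lam h => exact ⟨_, ⟨.lam h, hc, hc'⟩, hO.refl _⟩

theorem app_inv (hO : UpTo R O) {s t T' : Tm} (h : ClosedTmClosure R (Tm.app s t) T') :
    ∃ s' t', ClosedTmClosure R s s' ∧ ClosedTmClosure R t t' ∧ O (Tm.app s' t') T' := by
  obtain ⟨h, hc, hc'⟩ := h
  cases h with
  | base h =>
    rcases hO.base h with ⟨⟨b, hb⟩, -⟩ | h
    · cases hb
    · exact ⟨s, t, ⟨.refl R _, hc.1, hc.1⟩, ⟨.refl R _, hc.2, hc.2⟩, h⟩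
  | app h₁ h₂ => exact ⟨_, _, ⟨h₁, hc.1, hc'.1⟩, ⟨h₂, hc.2, hc'.2⟩, hO.refl _⟩

theorem shift_inv (hO : UpTo R O) {t T' : Tm} (h : ClosedTmClosure R (Tm.shift t) T') :
    ∃ t', TmClosure R t t' ∧ t.ClosedAt 1 ∧ t'.ClosedAt 1 ∧ O (Tm.shift t') T' := by
  obtain ⟨h, hc, hc'⟩ := h
  cases h with
  | base h =>
    rcases hO.base h with ⟨⟨b, hb⟩, -⟩ | h
    · cases hb
    · exact ⟨t, .refl R _, hc, hc, h⟩
  | shift h => exact ⟨_, h, hc, hc', hO.refl _⟩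

theorem reset_inv (hO : UpTo R O) {t T' : Tm} (h : ClosedTmClosure R (Tm.reset t) T') :
    ∃ t', ClosedTmClosure R t t' ∧ O (Tm.reset t') T' := by
  obtain ⟨h, hc, hc'⟩ := h
  cases h with
  | base h =>
    rcases hO.base h with ⟨⟨b, hb⟩, -⟩ | h
    · cases hb
    · exact ⟨t, ⟨.refl R _, hc, hc⟩, h⟩
  | reset h => exact ⟨_, ⟨h, hc, hc'⟩, hO.refl _⟩

theorem appLam_inv (hO : UpTo R O) {b t T' : Tm}
    (h : ClosedTmClosure R (Tm.app (Tm.lam b) t) T') :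
    ∃ b' t', ClosedTmClosure R (Tm.lam b) (Tm.lam b') ∧ ClosedTmClosure R t t' ∧
      O (Tm.app (Tm.lam b') t') T' := by
  obtain ⟨s', t', hs, ht, h⟩ := hO.app_inv h
  obtain ⟨b', hb, h'⟩ := hO.lam_inv hs
  exact ⟨b', t', hb, ht,
    hO.trans (hO.fill (F := .funOf .hole t') ⟨trivial, ht.2.2⟩ h') h⟩

/-- Decomposition of a left-hand term into an evaluation context and a subterm can be followed
on the right, up to `O`. -/
theorem fill_inv (hO : UpTo R O) (F : ECtx) {r T' : Tm}
    (h : ClosedTmClosure R (F.fill r) T') :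
    ∃ F' r', ECtxClosure R F F' ∧ ClosedTmClosure R r r' ∧ O (F'.fill r') T' := by
  induction F generalizing T' with
  | hole => exact ⟨.hole, T', .hole, h, hO.refl _⟩
  | argOf b F ih =>
    obtain ⟨b', t', hb, ht, h⟩ := hO.appLam_inv h
    obtain ⟨F', r', hF, hr, h'⟩ := ih ht
    exact ⟨.argOf b' F', r', .argOf hF hb, hr,
      hO.trans (hO.fill (F := .argOf b' .hole) ⟨hb.2.2, trivial⟩ h') h⟩
  | funOf F s ih =>
    obtain ⟨t', s', ht, hs, h⟩ := hO.app_inv h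
    obtain ⟨F', r', hF, hr, h'⟩ := ih ht
    exact ⟨.funOf F' s', r', .funOf hF hs, hr,
      hO.trans (hO.fill (F := .funOf .hole s') ⟨trivial, hs.2.2⟩ h') h⟩
  | reset F ih =>
    obtain ⟨t', ht, h⟩ := hO.reset_inv h
    obtain ⟨F', r', hF, hr, h'⟩ := ih ht
    exact ⟨.reset F', r', .reset hF, hr,
      hO.trans (hO.fill (F := .reset .hole) trivial h') h⟩

/-- A step on the left is matched, up to `O`, by a step on the right, unless it applies an
abstraction that is related by `R` itself. -/
theorem simulation (hO : UpTo R O) {T T' T₁ : Tm} (h : ClosedTmClosure R T T')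
    (hstep : Step T T₁) :
    (∃ S' T₁', O S' T' ∧ Step S' T₁' ∧ ClosedTmClosure R T₁ T₁') ∨
    (∃ F F' b b' c c', ECtxClosure R F F' ∧ (Tm.lam b, Tm.lam b') ∈ R ∧
      ClosedTmClosure R (Tm.lam c) (Tm.lam c') ∧
      T = F.fill (Tm.app (Tm.lam b) (Tm.lam c)) ∧ T₁ = F.fill (b.inst (Tm.lam c)) ∧
      O (F'.fill (Tm.app (Tm.lam b') (Tm.lam c'))) T') := by
  obtain ⟨F, r, r₁, hr, rfl, rfl⟩ := step_iff_headStep.1 hstep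
  obtain ⟨F', r', hF, hrr, h'⟩ := hO.fill_inv F h
  have hF' := hF.closed.2
  cases hr with
  | beta b c =>
    obtain ⟨b', t', hb, ht, hO₁⟩ := hO.appLam_inv hrr
    obtain ⟨c', hc, hO₂⟩ := hO.lam_inv ht
    have key : O (F'.fill (Tm.app (Tm.lam b') (Tm.lam c'))) T' :=
      hO.trans (hO.fill hF' (hO.trans
        (hO.fill (F := .argOf b' .hole) ⟨hb.2.2, trivial⟩ hO₂) hO₁)) h'
    obtain ⟨hb, hb₀, hb₁⟩ := hb
    cases hb with
    | base hb => exact .inr ⟨F, F', b, b', c, c', hF, hb, hc, rfl, rfl, key⟩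
    | lam hb =>
      refine .inl ⟨_, F'.fill (b'.inst (Tm.lam c')), key, .beta F' b' _ ⟨c', rfl⟩, hF.fill ?_⟩
      exact ⟨hb.inst hO.closedRel hc.1, Tm.ClosedAt.inst hb₀ hc.2.1, Tm.ClosedAt.inst hb₁ hc.2.2⟩
  | shift E t hE =>
    obtain ⟨u', hu, hO₁⟩ := hO.reset_inv hrr
    obtain ⟨E', w', hEE, hw, hO₂⟩ := hO.fill_inv E hu
    obtain ⟨t', ht, ht₀, ht₁, hO₃⟩ := hO.shift_inv hw
    have hk := hEE.captured hO.closedRel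
    refine .inl ⟨F'.fill (Tm.reset (E'.fill (Tm.shift t'))), _,
      hO.trans (hO.fill hF' (hO.trans (hO.fill (F := .reset .hole) trivial
        (hO.trans (hO.fill hEE.closed.2 hO₃) hO₂)) hO₁)) h',
      .shift F' E' t' (hEE.isPure hE), hF.fill ?_⟩
    exact ⟨.reset (ht.inst hO.closedRel hk.1), ht₀.inst hk.2.1, ht₁.inst hk.2.2⟩
  | reset b =>
    obtain ⟨u', hu, hO₁⟩ := hO.reset_inv hrr
    obtain ⟨b', hb, hO₂⟩ := hO.lam_inv hu
    exact .inl ⟨F'.fill (Tm.reset (Tm.lam b')), _,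
      hO.trans (hO.fill hF' (hO.trans (hO.fill (F := .reset .hole) trivial hO₂) hO₁)) h',
      .reset F' _ ⟨b', rfl⟩, hF.fill hb⟩

end UpTo

/-! ### Bisimilar terms in evaluation contexts -/

theorem IsEnvironment.upTo {Γ : Set (Tm × Tm)} (hΓ : IsEnvironment Γ) : UpTo Γ Eq where
  closedRel p hp := ⟨(hΓ p hp).2.1, (hΓ p hp).2.2.2⟩
  refl _ := rfl
  trans := Eq.trans
  fill _ h := h ▸ rfl
  base h := .inl ⟨(hΓ _ h).1, (hΓ _ h).2.2.1⟩

/-- If related programs can be exchanged in related contexts at `T`, then so can arbitrary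
related terms, provided that the contexts contain a reset: the programs are obtained by
testing the terms in the pure contexts below the innermost resets. -/
theorem IsEnvBisim.terminates_of_programs {X : EnvRel} (hX : IsEnvBisim X)
    {Γ : Set (Tm × Tm)} {T : Tm}
    (hprog : ∀ G G' p p', ECtxClosure Γ G G' → X.rel Γ (Tm.reset p) (Tm.reset p') →
      T = G.fill (Tm.reset p) → Terminates (G'.fill (Tm.reset p')))
    {F F' : ECtx} (hF : ECtxClosure Γ F F') (hpure : ¬ F.IsPure) {t t' : Tm}
    (ht : X.rel Γ t t') (hT : T = F.fill t) : Terminates (F'.fill t') := by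
  by_cases hp : t.IsProgram ∧ t'.IsProgram
  · obtain ⟨⟨p, rfl⟩, p', rfl⟩ := hp
    exact hprog F F' p p' hF ht hT
  · obtain ⟨G, G', E, E', hG, hE, hE₀, h₀, h₁⟩ := hF.exists_innermost_reset hpure
    rw [h₁]
    exact hprog G G' _ _ hG
      (hX.nonprogram Γ t t' ht hp E E' hE₀ (hE.isPure hE₀) hE) (hT.trans (h₀ t))

/-- Termination is transferred between terms built from an environment, and between related
programs in related contexts. -/
theorem IsEnvBisim.terminates_aux {X : EnvRel} (hX : IsEnvBisim X) {T : Tm}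
    (hT : Terminates T) (hQ : T.IsProgram ∨ T.IsValue) :
    (∀ Γ ∈ X.envs, ∀ T', ClosedTmClosure Γ T T' → Terminates T') ∧
    (∀ Γ G G' p p', ECtxClosure Γ G G' → X.rel Γ (Tm.reset p) (Tm.reset p') →
      T = G.fill (Tm.reset p) → Terminates (G'.fill (Tm.reset p'))) := by
  obtain ⟨v, hT⟩ := hT
  induction hT using Relation.ReflTransGen.head_induction_on with
  | refl =>
    refine ⟨fun Γ hΓ T' h => ?_, fun Γ G G' p p' _ _ h => ?_⟩
    · obtain ⟨b, -, rfl⟩ := (X.envs_env Γ hΓ).upTo.lam_inv h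
      exact terminates_lam b
    · exact absurd h.symm (G.fill_reset_ne_lam _ _)
  | @head T T₁ hstep hsteps ih =>
    obtain ⟨ihA, ihB⟩ := ih (isProgram_or_isValue_of_step hQ hstep)
    refine ⟨fun Γ hΓ T' h => ?_, fun Γ G G' p p' hG hp h => ?_⟩
    · rcases (X.envs_env Γ hΓ).upTo.simulation h hstep with
        ⟨_, T₁', rfl, hs, h₁⟩ | ⟨F, F', b, b', c, c', hF, hb, hc, rfl, rfl, rfl⟩
      · exact (ihA Γ hΓ T₁' h₁).of_steps (.single hs)
        -- The contexts contain a reset because the term on the left is a program.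
      · have hpure : ¬ F.IsPure := by
          cases F <;> simp [ECtx.fill, ECtx.IsPure, Tm.IsProgram, Tm.IsValue] at hQ ⊢
        exact (hX.terminates_of_programs (ihB Γ) hF hpure
          (hX.env Γ hΓ b b' hb _ _ ⟨c, rfl⟩ ⟨c', rfl⟩ hc) rfl).of_steps
          (.single (.beta F' b' _ ⟨c', rfl⟩))
    · subst h
      obtain ⟨q, hq, rfl⟩ := step_fill_reset_inv hstep
      rcases isProgram_or_isValue_of_step (.inl ⟨_, rfl⟩) hq with hqp | hqv
      · obtain ⟨_, ⟨q', rfl⟩, hs, hr⟩ :=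
          hX.step_left Γ _ _ hp ⟨_, rfl⟩ ⟨_, rfl⟩ q hqp hq
        obtain ⟨q, rfl⟩ := hqp
        exact (ihB Γ G G' q q' hG hr rfl).of_steps (hs.fill G')
      · obtain ⟨w, -, hs, hΓ'⟩ := hX.value_left Γ _ _ hp ⟨_, rfl⟩ ⟨_, rfl⟩ q hqv hq
        have hmem : (q, w) ∈ ({(q, w)} ∪ Γ : Set (Tm × Tm)) := .inl rfl
        obtain ⟨-, hc, -, hc'⟩ := X.envs_env _ hΓ' _ hmem
        exact (ihA _ hΓ' _ ((hG.mono Set.subset_union_right).fill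
          ⟨.base hmem, hc, hc'⟩)).of_steps (hs.fill G')

/-- Observational preorder: termination in closed evaluation contexts below a top-level reset is
preserved when `s` is replaced by `t`. -/
def ObsLE (s t : Tm) : Prop :=
  ∀ G : ECtx, G.Closed → Terminates (Tm.reset (G.fill s)) → Terminates (Tm.reset (G.fill t))

theorem IsEnvBisim.obsLE {X : EnvRel} (hX : IsEnvBisim X) {t₀ t₁ : Tm}
    (h : X.rel ∅ t₀ t₁) : ObsLE t₀ t₁ := fun G hG hT =>
  hX.terminates_of_programs ((hX.terminates_aux hT (.inl ⟨_, rfl⟩)).2 ∅)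
    (F := .reset G) (F' := .reset G) (.refl ∅ hG) id h rfl

/-! ### From evaluation contexts to arbitrary contexts -/

theorem ObsLE.upTo_singleton {t₀ t₁ : Tm} (h : ObsLE t₀ t₁) (h₀ : t₀.Closed) (h₁ : t₁.Closed) :
    UpTo {(t₀, t₁)} ObsLE where
  closedRel := by
    rintro _ rfl
    exact ⟨h₀, h₁⟩
  refl _ _ _ := id
  trans hst htu G hG := htu G hG ∘ hst G hG
  fill {F s t} hF hst G hG := by
    simpa only [ECtx.fill_comp] using hst (G.comp F) (hG.comp hF)
  base := by
    rintro _ _ ⟨⟩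
    exact .inr h

/-- The right-hand side is placed below a reset, since this is where `ObsLE` can be observed. -/
theorem terminates_of_tmClosure_singleton {t₀ t₁ : Tm} (hle : ObsLE t₀ t₁) (h₀ : t₀.Closed)
    (h₁ : t₁.Closed) {T T' : Tm} (hT : Terminates T)
    (h : ClosedTmClosure {(t₀, t₁)} T T') : Terminates (Tm.reset T') := by
  have hO := hle.upTo_singleton h₀ h₁
  obtain ⟨v, hT⟩ := hT
  induction hT using Relation.ReflTransGen.head_induction_on generalizing T' with
  | refl =>
    obtain ⟨b, -, hb⟩ := hO.lam_inv h
    exact hb .hole trivial ⟨b, .single (.reset .hole _ ⟨b, rfl⟩)⟩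
  | @head T T₁ hstep hsteps ih =>
    suffices ∃ S' T₁', ObsLE S' T' ∧ Step S' T₁' ∧ ClosedTmClosure {(t₀, t₁)} T₁ T₁' by
      obtain ⟨S', T₁', hle', hs, h'⟩ := this
      exact hle' .hole trivial ((ih h').of_steps (.single (hs.fill (.reset .hole))))
    rcases hO.simulation h hstep with h' | ⟨F, F', b, b', c, c', hF, hb, hc, rfl, rfl, hle'⟩
    · exact h'
      -- The applied abstractions are `t₀` and `t₁`; on the right, `t₁` is exchanged for `t₀`.
    · obtain ⟨rfl, rfl⟩ := Prod.mk.inj hb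
      refine ⟨F'.fill (Tm.app (Tm.lam b) (Tm.lam c')), F'.fill (b.inst (Tm.lam c')),
        hO.trans (hO.fill hF.closed.2
          (hO.fill (F := .funOf .hole (Tm.lam c')) ⟨trivial, hc.2.2⟩ hle)) hle',
        .beta F' b _ ⟨c', rfl⟩, hF.fill ?_⟩
      exact ⟨(TmClosure.refl _ b).inst hO.closedRel hc.1, Tm.ClosedAt.inst h₀ hc.2.1,
        Tm.ClosedAt.inst h₀ hc.2.2⟩

theorem ObsLE.ctxFill {t₀ t₁ : Tm} (hle : ObsLE t₀ t₁) (h₀ : t₀.Closed) (h₁ : t₁.Closed)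
    {C : Ctx} (hC₀ : (Tm.reset (C.fill t₀)).Closed) (hC₁ : (Tm.reset (C.fill t₁)).Closed)
    (h : EvaluatesToValue (Tm.reset (C.fill t₀))) :
    EvaluatesToValue (Tm.reset (C.fill t₁)) := by
  rw [evaluatesToValue_iff] at h ⊢
  exact (terminates_of_tmClosure_singleton hle h₀ h₁ h
    ⟨.reset ((TmClosure.base (Set.mem_singleton _)).ctxFill C), hC₀, hC₁⟩).of_reset_reset

/-! ### Symmetry of bisimilarity -/

theorem TmClosure.swap {R : Set (Tm × Tm)} {t t' : Tm}
    (h : TmClosure (Prod.swap ⁻¹' R) t t') : TmClosure R t' t := by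
  induction h with
  | base h => exact .base h
  | var i => exact .var i
  | lam _ ih => exact .lam ih
  | app _ _ ihs iht => exact .app ihs iht
  | shift _ ih => exact .shift ih
  | reset _ ih => exact .reset ih

theorem ClosedTmClosure.swap {R : Set (Tm × Tm)} {t t' : Tm}
    (h : ClosedTmClosure (Prod.swap ⁻¹' R) t t') : ClosedTmClosure R t' t :=
  ⟨h.1.swap, h.2.2, h.2.1⟩

theorem ECtxClosure.swap {R : Set (Tm × Tm)} {F F' : ECtx}
    (h : ECtxClosure (Prod.swap ⁻¹' R) F F') : ECtxClosure R F' F := by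
  induction h with
  | hole => exact .hole
  | argOf _ hb ih => exact .argOf ih hb.swap
  | funOf _ ht ih => exact .funOf ih ht.swap
  | reset _ ih => exact .reset ih

theorem IsEnvironment.of_swap {Γ : Set (Tm × Tm)} (h : IsEnvironment (Prod.swap ⁻¹' Γ)) :
    IsEnvironment Γ := fun p hp =>
  have h := h p.swap (by simpa using hp)
  ⟨h.2.2.1, h.2.2.2, h.1, h.2.1⟩

/-- The converse of an environmental relation: environments and terms are exchanged. -/
def EnvRel.swap (X : EnvRel) : EnvRel where
  envs := {Γ | Prod.swap ⁻¹' Γ ∈ X.envs}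
  rel Γ t₀ t₁ := X.rel (Prod.swap ⁻¹' Γ) t₁ t₀
  envs_env _ h := (X.envs_env _ h).of_swap
  rel_env _ _ _ h := (X.rel_env _ _ _ h).of_swap
  rel_closed _ _ _ h := (X.rel_closed _ _ _ h).symm

theorem swap_preimage_insert (v₀ v₁ : Tm) (Γ : Set (Tm × Tm)) :
    Prod.swap ⁻¹' ({(v₀, v₁)} ∪ Γ) = {(v₁, v₀)} ∪ Prod.swap ⁻¹' Γ := by
  ext ⟨a, b⟩
  simp [and_comm]

theorem IsEnvBisim.swap {X : EnvRel} (hX : IsEnvBisim X) : IsEnvBisim X.swap where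
  nonprogram Γ t₀ t₁ h hn E₀ E₁ h₀ h₁ hE :=
    hX.nonprogram _ t₁ t₀ h (fun h => hn h.symm) E₁ E₀ h₁ h₀ (ECtxClosure.swap hE)
  step_left Γ p₀ p₁ h h₀ h₁ := hX.step_right _ p₁ p₀ h h₁ h₀
  step_right Γ p₀ p₁ h h₀ h₁ := hX.step_left _ p₁ p₀ h h₁ h₀
  value_left Γ p₀ p₁ h h₀ h₁ v hv hs := by
    obtain ⟨w, hw, hws, hΓ⟩ := hX.value_right _ p₁ p₀ h h₁ h₀ v hv hs
    exact ⟨w, hw, hws, by simpa only [EnvRel.swap, Set.mem_ofPred_eq, swap_preimage_insert]⟩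
  value_right Γ p₀ p₁ h h₀ h₁ v hv hs := by
    obtain ⟨w, hw, hws, hΓ⟩ := hX.value_left _ p₁ p₀ h h₁ h₀ v hv hs
    exact ⟨w, hw, hws, by simpa only [EnvRel.swap, Set.mem_ofPred_eq, swap_preimage_insert]⟩
  env Γ hΓ b₀ b₁ hb v₀ v₁ h₀ h₁ hv := hX.env _ hΓ b₁ b₀ hb v₁ v₀ h₁ h₀ (ClosedTmClosure.swap hv)

end ShiftReset

theorem mainTheorem3 (t₀ t₁ : ShiftReset.Tm) (h : ShiftReset.Bisimilar t₀ t₁) :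
    ShiftReset.CtxEquiv t₀ t₁ := by
  obtain ⟨X, hX, h⟩ := h
  obtain ⟨h₀, h₁⟩ := X.rel_closed _ _ _ h
  exact fun C hC₀ hC₁ =>
    ⟨(hX.obsLE h).ctxFill h₀ h₁ hC₀ hC₁,
      (hX.swap.obsLE (t₀ := t₁) (t₁ := t₀) h).ctxFill h₁ h₀ hC₁ hC₀⟩
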